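/- Let $G=(V,E)$ be a finite simple graph with at least one vertex, with adjacency matrix $A$ and diagonal degree matrix $D$. Let $B$ be its non-backtracking matrix, indexed by the directed edges of $G$, with $B_{i\to j,\,k\to \ell}=1$ if $j=k$ and $i\neq \ell$, and $0$ otherwise. Let $\rho$ be the spectral radius of $B$ (with $\rho=0$ if $G$ has no edges), and for real $z$ let $$L(z)=z^2\mathbb{1}-zA+D-\mathbb{1}$$ be the deformed Laplacian. Let $m\ge 1$ be an integer and suppose that $G$ has girth at least $2m+1$ (the girth of a graph without cycles is $\infty$). Then for every real $z<0$, $$L(z)\not\succeq \Big((z+\sqrt\rho)^2-\frac{2\sqrt\rho\, z}{m}\Big)\mathbb{1},$$ that is, the smallest eigenvalue of $L(z)$ is strictly less than $(z+\sqrt\rho)^2-2\sqrt\rho\,z/m$. Moreover, there is a single positive semidefinite matrix $X\in\mathbb{R}^{V\times V}$ with $\operatorname{Tr}X=1$ such that, for every real $z<0$, $$\langle X,L(z)\rangle=\operatorname{Tr}(X\,L(z))\le (z+\sqrt\rho)^2-\frac{2\sqrt\rho\, z}{m}.$$ -/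

import Mathlib

/-- The non-backtracking matrix of a graph, indexed by its directed edges: the entry at
`(i → j, k → l)` is `1` if `j = k` and `i ≠ l`, and `0` otherwise. -/
def SimpleGraph.nonBacktrackingMatrix {V : Type*} [DecidableEq V] (G : SimpleGraph V)
    (R : Type*) [Zero R] [One R] : Matrix G.Dart G.Dart R :=
  Matrix.of fun e f => if e.snd = f.fst ∧ e.fst ≠ f.snd then 1 else 0

/-- The spectral radius `ρ` of the non-backtracking matrix: the largest modulus of its complex
eigenvalues (and `0` if the graph has no edges). -/
noncomputable def SimpleGraph.nonBacktrackingRadius {V : Type*} [Fintype V] [DecidableEq V]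
    (G : SimpleGraph V) [DecidableRel G.Adj] : ℝ :=
  (spectralRadius ℂ (G.nonBacktrackingMatrix ℂ)).toReal

/-- The deformed Laplacian (Bethe Hessian) `L(z) = z² 1 - z A + D - 1` at a real point `z`. -/
def SimpleGraph.deformedLaplacian {V : Type*} [Fintype V] [DecidableEq V]
    (G : SimpleGraph V) [DecidableRel G.Adj] (z : ℝ) : Matrix V V ℝ :=
  z ^ 2 • (1 : Matrix V V ℝ) - z • G.adjMatrix ℝ + G.degMatrix ℝ - 1

/-!
Let `N_s(e, v)` count the non-backtracking walks that start with the directed edge `e` and end at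
`v` after `s` further steps, and put `z₀ = -√ρ`. The rows of `F = ∑ s < m, z₀⁻ˢ N_s` are trial
vectors for `L`. Since `N_s = B ^ s N_0` satisfies the Chebyshev-like recurrence
`N_{s+1} A = N_{s+2} + N_s (D - 1)`, the product `F L(z₀)` telescopes to boundary terms. Below the
girth, walks of different lengths with the same first edge have different endpoints, so
`F e ⬝ᵥ F e` and `F e ⬝ᵥ (F L(z₀)) e` contain no cross terms. Weighting the rows by a nonnegative
left Perron eigenvector of `B` makes all `m` lengths contribute equally, and the weighted Gram
matrix `X` satisfies `Tr (X L(z)) = (z + √ρ)² - 2√ρ z / m` exactly.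

If `L(z) - c` were positive semidefinite for this value `c`, every trial vector with positive
weight would lie in its kernel; but the row of `F (L(z) - c)` at `e` has entry `-z` at the tail of
`e`.

When `ρ = 0` some vertex has degree at most one, and its indicator vector is used instead.
-/

namespace PerronFrobenius

open Filter Topology
open scoped Matrix

variable {n : Type*} [Fintype n] [DecidableEq n]

/-- The largest modulus of the complex eigenvalues of a real square matrix, as a real number; for
entrywise nonnegative matrices this is the Perron root. -/
noncomputable def perronRoot (M : Matrix n n ℝ) : ℝ :=
  (spectralRadius ℂ (M.map Complex.ofReal)).toReal

theorem perronRoot_nonneg (M : Matrix n n ℝ) : 0 ≤ perronRoot M := ENNReal.toReal_nonneg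

theorem perronRoot_transpose (M : Matrix n n ℝ) : perronRoot Mᵀ = perronRoot M := by
  have hspec : spectrum ℂ (M.map Complex.ofReal)ᵀ = spectrum ℂ (M.map Complex.ofReal) := by
    ext μ
    rw [Matrix.mem_spectrum_iff_isRoot_charpoly, Matrix.charpoly_transpose,
      ← Matrix.mem_spectrum_iff_isRoot_charpoly]
  rw [perronRoot, perronRoot, Matrix.transpose_map, spectralRadius, spectralRadius, hspec]

section Norm

attribute [local instance] Matrix.linftyOpNormedRing Matrix.linftyOpNormedAlgebra

theorem tendsto_norm_pow_rpow_perronRoot [Nonempty n] (M : Matrix n n ℝ) :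
    Tendsto (fun k : ℕ => ‖M ^ k‖ ^ (1 / k : ℝ)) atTop (𝓝 (perronRoot M)) := by
  have hfin : spectralRadius ℂ (M.map Complex.ofReal) ≠ ⊤ :=
    ((spectrum.spectralRadius_le_nnnorm _).trans_lt ENNReal.coe_lt_top).ne
  have hpow (k : ℕ) : ‖(M.map Complex.ofReal) ^ k‖ = ‖M ^ k‖ := by
    have h : (M ^ k).map Complex.ofReal = M.map Complex.ofReal ^ k :=
      Matrix.map_pow (f := Complex.ofRealHom) M k
    simp [← h, Matrix.linfty_opNorm_def]
  refine ((ENNReal.tendsto_toReal hfin).comp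
    (spectrum.pow_norm_pow_one_div_tendsto_nhds_spectralRadius (M.map Complex.ofReal))).congr
      fun k => ?_
  rw [Function.comp_apply, ENNReal.toReal_ofReal (by positivity), hpow]

theorem exists_eigenvector_norm_eq_perronRoot [Nonempty n] (M : Matrix n n ℝ) :
    ∃ (μ : ℂ) (v : n → ℂ), ‖μ‖ = perronRoot M ∧ v ≠ 0 ∧ M.map Complex.ofReal *ᵥ v = μ • v := by
  obtain ⟨μ, hμ, hnorm⟩ := spectrum.exists_nnnorm_eq_spectralRadius (M.map Complex.ofReal)
  rw [← Matrix.spectrum_toLin', ← Module.End.hasEigenvalue_iff_mem_spectrum] at hμ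
  obtain ⟨v, hv⟩ := hμ.exists_hasEigenvector
  exact ⟨μ, v, by simp [perronRoot, ← hnorm], hv.2, by simpa using hv.apply_eq_smul⟩

end Norm

omit [DecidableEq n] in
theorem mulVec_mono {l : Type*} {M : Matrix l n ℝ} (hM : ∀ i j, 0 ≤ M i j) {x y : n → ℝ}
    (hxy : x ≤ y) : M *ᵥ x ≤ M *ᵥ y :=
  fun i => dotProduct_le_dotProduct_of_nonneg_left hxy (hM i)

section Nonneg

variable {M : Matrix n n ℝ} (hM : ∀ i j, 0 ≤ M i j)

include hM

theorem pow_smul_le_pow_mulVec {t : ℝ} (ht : 0 ≤ t) {y : n → ℝ} (hy : t • y ≤ M *ᵥ y) (k : ℕ) :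
    t ^ k • y ≤ M ^ k *ᵥ y := by
  induction k with
  | zero => simp
  | succ k ih =>
    calc t ^ (k + 1) • y = t ^ k • t • y := by rw [pow_succ, mul_smul]
      _ ≤ t ^ k • M *ᵥ y := smul_le_smul_of_nonneg_left hy (pow_nonneg ht k)
      _ = M *ᵥ (t ^ k • y) := (Matrix.mulVec_smul ..).symm
      _ ≤ M *ᵥ (M ^ k *ᵥ y) := mulVec_mono hM ih
      _ = M ^ (k + 1) *ᵥ y := by rw [Matrix.mulVec_mulVec, pow_succ']

section Norm

attribute [local instance] Matrix.linftyOpNormedRing Matrix.linftyOpNormedAlgebra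

theorem le_perronRoot_of_smul_le_mulVec {t : ℝ} {y : n → ℝ} (hy : 0 ≤ y) (hy0 : y ≠ 0)
    (h : t • y ≤ M *ᵥ y) : t ≤ perronRoot M := by
  rcases lt_or_ge t 0 with ht | ht
  · exact ht.le.trans (perronRoot_nonneg M)
  have : Nonempty n := (Function.ne_iff.1 hy0).nonempty
  have hpow (k : ℕ) : t ^ k ≤ ‖M ^ k‖ := by
    have hnonneg : 0 ≤ t ^ k • y := smul_nonneg (pow_nonneg ht k) hy
    have hmono : ‖t ^ k • y‖ ≤ ‖M ^ k *ᵥ y‖ := by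
      refine (pi_norm_le_iff_of_nonneg (norm_nonneg _)).2 fun i => ?_
      rw [Real.norm_of_nonneg (hnonneg i)]
      exact (pow_smul_le_pow_mulVec hM ht h k i).trans
        ((Real.le_norm_self _).trans (norm_le_pi_norm (M ^ k *ᵥ y) i))
    rw [norm_smul, Real.norm_of_nonneg (pow_nonneg ht k)] at hmono
    exact le_of_mul_le_mul_right (hmono.trans (Matrix.linfty_opNorm_mulVec _ _))
      (norm_pos_iff.2 hy0)
  refine ge_of_tendsto (tendsto_norm_pow_rpow_perronRoot M) ?_
  filter_upwards [eventually_ne_atTop 0] with k hk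
  calc t = (t ^ k) ^ (1 / k : ℝ) := by rw [one_div, Real.pow_rpow_inv_natCast ht hk]
    _ ≤ ‖M ^ k‖ ^ (1 / k : ℝ) := Real.rpow_le_rpow (pow_nonneg ht k) (hpow k) (by positivity)

end Norm

theorem nonneg_of_mulVec_le_smul {t : ℝ} (ht : perronRoot M < t) {x : n → ℝ}
    (hx : M *ᵥ x ≤ t • x) : 0 ≤ x := by
  have hneg : t • x⁻ ≤ M *ᵥ x⁻ := by
    intro i
    rcases le_total 0 (x i) with hi | hi
    · have hnonneg : M *ᵥ 0 ≤ M *ᵥ x⁻ := mulVec_mono hM (negPart_nonneg x)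
      simpa [Pi.negPart_apply, negPart_eq_zero.2 hi] using hnonneg i
    · have hle : M *ᵥ (-x) ≤ M *ᵥ x⁻ := mulVec_mono hM (neg_le_negPart x)
      rw [Matrix.mulVec_neg] at hle
      calc (t • x⁻) i = -(t • x) i := by simp [Pi.negPart_apply, negPart_of_nonpos hi]
        _ ≤ -(M *ᵥ x) i := neg_le_neg (hx i)
        _ ≤ (M *ᵥ x⁻) i := hle i
  by_contra hx0
  exact ht.not_ge (le_perronRoot_of_smul_le_mulVec hM (negPart_nonneg x)
    (mt negPart_eq_zero.1 hx0) hneg)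

theorem exists_mulVec_eq_smul_sub {t : ℝ} (ht : perronRoot M < t) (y : n → ℝ) :
    ∃ x, M *ᵥ x = t • x - y := by
  have hinj : Function.Injective (t • (1 : Matrix n n ℝ) - M).mulVec := by
    rw [← Matrix.coe_mulVecLin, injective_iff_map_eq_zero]
    intro x hx
    have heig : M *ᵥ x = t • x := by
      simpa [Matrix.sub_mulVec, Matrix.smul_mulVec, sub_eq_zero, eq_comm] using hx
    have hnonpos : 0 ≤ -x := nonneg_of_mulVec_le_smul hM ht (by simp [Matrix.mulVec_neg, heig])
    exact le_antisymm (neg_nonneg.1 hnonpos) (nonneg_of_mulVec_le_smul hM ht heig.le)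
  obtain ⟨x, hx⟩ := Matrix.mulVec_surjective_iff_isUnit.2
    (Matrix.mulVec_injective_iff_isUnit.1 hinj) y
  refine ⟨x, ?_⟩
  rw [← hx, Matrix.sub_mulVec, Matrix.smul_mulVec, Matrix.one_mulVec, sub_sub_cancel]

theorem exists_perronRoot_smul_le_mulVec [Nonempty n] :
    ∃ y : n → ℝ, 0 ≤ y ∧ y ≠ 0 ∧ perronRoot M • y ≤ M *ᵥ y := by
  obtain ⟨μ, v, hμ, hv0, hv⟩ := exists_eigenvector_norm_eq_perronRoot M
  refine ⟨fun i => ‖v i‖, fun i => norm_nonneg _, fun h => hv0 ?_, fun i => ?_⟩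
  · exact funext fun i => norm_eq_zero.1 (congrFun h i)
  · calc perronRoot M * ‖v i‖ = ‖(M.map Complex.ofReal *ᵥ v) i‖ := by simp [hv, hμ]
      _ ≤ ∑ j, ‖M.map Complex.ofReal i j * v j‖ := norm_sum_le _ _
      _ = ∑ j, M i j * ‖v j‖ := by simp [abs_of_nonneg (hM i _)]

theorem exists_mem_stdSimplex_mulVec_mem_Icc [Nonempty n] {t : ℝ} (ht : perronRoot M < t) :
    ∃ u ∈ stdSimplex ℝ n, M *ᵥ u ∈ Set.Icc (perronRoot M • u) (t • u) := by
  -- `u` is the normalised resolvent `(t - M)⁻¹ y`.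
  obtain ⟨y, hy, hy0, hMy⟩ := exists_perronRoot_smul_le_mulVec hM
  obtain ⟨x, hx⟩ := exists_mulVec_eq_smul_sub hM ht y
  have hx_nonneg : 0 ≤ x := nonneg_of_mulVec_le_smul hM ht (hx ▸ sub_le_self _ hy)
  have hyx : y ≤ (t - perronRoot M) • x := by
    refine sub_nonneg.1 (nonneg_of_mulVec_le_smul hM ht ?_)
    rw [Matrix.mulVec_sub, Matrix.mulVec_smul, hx]
    intro i
    have := hMy i
    simp only [Pi.sub_apply, Pi.smul_apply, smul_eq_mul] at this ⊢
    linarith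
  have hx0 : x ≠ 0 := fun h => hy0 (le_antisymm (by simpa [h] using hyx) hy)
  have hsum : 0 < ∑ i, x i := Fintype.sum_pos (hx_nonneg.lt_of_ne' hx0)
  refine ⟨(∑ i, x i)⁻¹ • x, ⟨fun i => ?_, ?_⟩, ?_⟩
  · exact mul_nonneg (inv_nonneg.2 hsum.le) (hx_nonneg i)
  · simp [← Finset.mul_sum, hsum.ne']
  · rw [Matrix.mulVec_smul, smul_comm, smul_comm t]
    have hinv := inv_nonneg.2 hsum.le
    exact ⟨smul_le_smul_of_nonneg_left (by rw [hx]; rwa [sub_smul, le_sub_comm] at hyx) hinv,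
      smul_le_smul_of_nonneg_left (hx ▸ sub_le_self _ hy) hinv⟩

theorem exists_mem_stdSimplex_mulVec_eq [Nonempty n] :
    ∃ w ∈ stdSimplex ℝ n, M *ᵥ w = perronRoot M • w := by
  let residual (u : n → ℝ) : ℝ := ‖M *ᵥ u - perronRoot M • u‖
  have hcont : Continuous residual := by fun_prop
  obtain ⟨w, hw, hmin⟩ := (isCompact_stdSimplex ℝ n).exists_isMinOn
    ⟨_, single_mem_stdSimplex ℝ (Classical.arbitrary n)⟩ hcont.continuousOn
  refine ⟨w, hw, sub_eq_zero.1 (norm_le_zero_iff.1 (le_of_forall_pos_le_add fun ε hε => ?_))⟩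
  obtain ⟨u, hu, hlower, hupper⟩ :=
    exists_mem_stdSimplex_mulVec_mem_Icc hM (lt_add_of_pos_right (perronRoot M) hε)
  refine (hmin hu).trans ((pi_norm_le_iff_of_nonneg (by positivity)).2 fun i => ?_)
  have hui : u i ≤ 1 := (mem_Icc_of_mem_stdSimplex hu i).2
  have hl := hlower i
  have hr := hupper i
  simp only [Pi.smul_apply, smul_eq_mul] at hl hr
  rw [Pi.sub_apply, Pi.smul_apply, smul_eq_mul, Real.norm_of_nonneg (sub_nonneg.2 hl)]
  nlinarith

end Nonneg

theorem exists_mem_stdSimplex_vecMul_eq [Nonempty n] {M : Matrix n n ℝ} (hM : ∀ i j, 0 ≤ M i j) :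
    ∃ w ∈ stdSimplex ℝ n, w ᵥ* M = perronRoot M • w := by
  obtain ⟨w, hw, heig⟩ := exists_mem_stdSimplex_mulVec_eq (M := Mᵀ) fun i j => hM j i
  exact ⟨w, hw, by rwa [Matrix.mulVec_transpose, perronRoot_transpose] at heig⟩

end PerronFrobenius

namespace NonBacktracking

open scoped Matrix

section WeightedGram

variable {ι V : Type*} [Fintype ι] [DecidableEq ι]

/-- The weighted Gram matrix `∑ e, w e • (F e)(F e)ᵀ` of the rows of `F`. -/
def weightedGram (F : Matrix ι V ℝ) (w : ι → ℝ) : Matrix V V ℝ :=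
  Fᵀ * Matrix.diagonal w * F

theorem posSemidef_weightedGram [Finite V] (F : Matrix ι V ℝ) {w : ι → ℝ} (hw : 0 ≤ w) :
    (weightedGram F w).PosSemidef := by
  simpa [weightedGram] using (Matrix.PosSemidef.diagonal hw).conjTranspose_mul_mul_same F

variable [Fintype V]

theorem trace_weightedGram_mul (F : Matrix ι V ℝ) (w : ι → ℝ) (M : Matrix V V ℝ) :
    (weightedGram F w * M).trace = w ⬝ᵥ fun e => F e ⬝ᵥ (F * M) e := by
  rw [weightedGram, Matrix.mul_assoc, Matrix.mul_assoc, Matrix.trace_mul_comm, Matrix.mul_assoc,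
    Matrix.trace]
  refine Finset.sum_congr rfl fun e _ => ?_
  rw [Matrix.diag_apply, Matrix.diagonal_mul]
  exact congrArg (w e * ·) (dotProduct_comm _ _)

theorem mul_row_eq_zero_of_trace_nonpos {F : Matrix ι V ℝ} {w : ι → ℝ} (hw : 0 ≤ w)
    {M : Matrix V V ℝ} (hM : M.PosSemidef) (htrace : (weightedGram F w * M).trace ≤ 0)
    {e : ι} (he : w e ≠ 0) : (F * M) e = 0 := by
  have hrow (i : ι) : (F * M) i = M *ᵥ F i := by
    rw [← Matrix.vecMul_transpose, ← Matrix.conjTranspose_eq_transpose_of_trivial,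
      hM.isHermitian.eq]
    rfl
  have hquad (i : ι) : 0 ≤ F i ⬝ᵥ (F * M) i := by
    simpa [hrow] using hM.dotProduct_mulVec_nonneg (F i)
  have hterm : 0 ≤ fun i => w i * (F i ⬝ᵥ (F * M) i) := fun i => mul_nonneg (hw i) (hquad i)
  rw [trace_weightedGram_mul] at htrace
  have hzero : w e * (F e ⬝ᵥ (F * M) e) = 0 :=
    congrFun ((Fintype.sum_eq_zero_iff_of_nonneg hterm).1
      (htrace.antisymm (Finset.sum_nonneg fun i _ => hterm i))) e
  rw [hrow]
  refine (hM.dotProduct_mulVec_zero_iff (F e)).1 ?_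
  rw [star_trivial, ← hrow]
  exact (mul_eq_zero.1 hzero).resolve_left he

variable [DecidableEq V]

theorem not_posSemidef_sub_smul_one {F : Matrix ι V ℝ} {w : ι → ℝ} (hw : 0 ≤ w)
    {A : Matrix V V ℝ} {c : ℝ}
    (htrace : (weightedGram F w * A).trace ≤ c * (weightedGram F w).trace) {e : ι} (he : w e ≠ 0)
    (hrow : (F * (A - c • (1 : Matrix V V ℝ))) e ≠ 0) :
    ¬ (A - c • (1 : Matrix V V ℝ)).PosSemidef := by
  refine fun hM => hrow (mul_row_eq_zero_of_trace_nonpos hw hM ?_ he)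
  simpa [Matrix.mul_sub] using htrace

end WeightedGram

theorem dotProduct_pow_mulVec {n : Type*} [Fintype n] [DecidableEq n] {M : Matrix n n ℝ}
    {w : n → ℝ} {r : ℝ} (hw : w ᵥ* M = r • w) (k : ℕ) (x : n → ℝ) :
    w ⬝ᵥ (M ^ k *ᵥ x) = r ^ k * (w ⬝ᵥ x) := by
  induction k with
  | zero => simp
  | succ k ih =>
    rw [pow_succ', ← Matrix.mulVec_mulVec, Matrix.dotProduct_mulVec, hw, smul_dotProduct, ih,
      smul_eq_mul, pow_succ', mul_assoc]

section Incidence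

variable {V : Type*} [Fintype V] [DecidableEq V] (G : SimpleGraph V) [DecidableRel G.Adj]

/-- The incidence matrix between directed edges and their heads. -/
def headMatrix : Matrix G.Dart V ℝ := Matrix.of fun e v => if e.snd = v then 1 else 0

/-- The incidence matrix between directed edges and their tails. -/
def tailMatrix : Matrix G.Dart V ℝ := Matrix.of fun e v => if e.fst = v then 1 else 0

/-- The permutation matrix of the reversal of directed edges. -/
def reversalMatrix : Matrix G.Dart G.Dart ℝ :=
  (SimpleGraph.Dart.symm_involutive (G := G)).toPerm.permMatrix ℝ

/-- The number `deg v - 1` of continuations of a non-backtracking walk that has arrived at `v`. -/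
def branching (v : V) : ℝ := G.degree v - 1

omit [DecidableRel G.Adj] in
theorem nonBacktrackingMatrix_add_reversalMatrix :
    G.nonBacktrackingMatrix ℝ + reversalMatrix G = headMatrix G * (tailMatrix G)ᵀ := by
  ext e f
  have hsymm : e.symm = f ↔ e.snd = f.fst ∧ e.fst = f.snd := by
    rw [SimpleGraph.Dart.ext_iff, Prod.ext_iff]
    rfl
  by_cases h1 : e.snd = f.fst <;> by_cases h2 : e.fst = f.snd <;>
    simp [SimpleGraph.nonBacktrackingMatrix, reversalMatrix, Equiv.Perm.permMatrix, headMatrix,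
      tailMatrix, Matrix.mul_apply, PEquiv.toMatrix_apply, hsymm, h1, h2]

theorem reversalMatrix_mul_headMatrix : reversalMatrix G * headMatrix G = tailMatrix G := by
  rw [reversalMatrix, Equiv.Perm.permMatrix, PEquiv.toMatrix_toPEquiv_mul]
  rfl

theorem reversalMatrix_mul_tailMatrix : reversalMatrix G * tailMatrix G = headMatrix G := by
  rw [reversalMatrix, Equiv.Perm.permMatrix, PEquiv.toMatrix_toPEquiv_mul]
  rfl

theorem tailMatrix_transpose_mul_headMatrix :
    (tailMatrix G)ᵀ * headMatrix G = G.adjMatrix ℝ := by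
  ext u v
  simp only [Matrix.mul_apply, Matrix.transpose_apply, tailMatrix, headMatrix, Matrix.of_apply,
    SimpleGraph.adjMatrix_apply, mul_ite, mul_one, mul_zero, ← ite_and]
  by_cases h : G.Adj u v
  · rw [if_pos h, Fintype.sum_eq_single ⟨(u, v), h⟩, if_pos ⟨rfl, rfl⟩]
    exact fun e he => if_neg fun hv => he (SimpleGraph.Dart.ext _ _ (Prod.ext hv.2 hv.1))
  · rw [if_neg h]
    exact Finset.sum_eq_zero fun e _ => if_neg fun ⟨hv, hu⟩ => h (hu ▸ hv ▸ e.adj)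

theorem tailMatrix_transpose_mul_tailMatrix :
    (tailMatrix G)ᵀ * tailMatrix G = G.degMatrix ℝ := by
  ext u v
  simp only [Matrix.mul_apply, Matrix.transpose_apply, tailMatrix, Matrix.of_apply,
    SimpleGraph.degMatrix, Matrix.diagonal_apply, mul_ite, mul_one, mul_zero, ← ite_and]
  split_ifs with h
  · simp [h, ← G.dart_fst_fiber_card_eq_degree]
  · exact Finset.sum_eq_zero fun e _ => if_neg fun huv => h (huv.2.symm.trans huv.1)

theorem headMatrix_mul_adjMatrix :
    headMatrix G * G.adjMatrix ℝ = G.nonBacktrackingMatrix ℝ * headMatrix G + tailMatrix G := by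
  rw [← tailMatrix_transpose_mul_headMatrix, ← Matrix.mul_assoc,
    ← nonBacktrackingMatrix_add_reversalMatrix, Matrix.add_mul, reversalMatrix_mul_headMatrix]

theorem degMatrix_eq : G.degMatrix ℝ = Matrix.diagonal (branching G) + 1 := by
  rw [← Matrix.diagonal_one, Matrix.diagonal_add]
  simp [branching, SimpleGraph.degMatrix]

theorem nonBacktrackingMatrix_mul_tailMatrix :
    G.nonBacktrackingMatrix ℝ * tailMatrix G =
      headMatrix G * Matrix.diagonal (branching G) := by
  rw [← add_left_inj (headMatrix G)]
  calc _ = (G.nonBacktrackingMatrix ℝ + reversalMatrix G) * tailMatrix G := by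
        rw [Matrix.add_mul, reversalMatrix_mul_tailMatrix]
    _ = headMatrix G * G.degMatrix ℝ := by
        rw [nonBacktrackingMatrix_add_reversalMatrix, Matrix.mul_assoc,
          tailMatrix_transpose_mul_tailMatrix]
    _ = _ := by rw [degMatrix_eq, Matrix.mul_add, Matrix.mul_one]

omit [DecidableRel G.Adj] in
theorem headMatrix_mulVec_one : headMatrix G *ᵥ 1 = 1 := by
  ext e
  simp [headMatrix, Matrix.mulVec, dotProduct]

omit [DecidableRel G.Adj] in
theorem tailMatrix_mulVec_one : tailMatrix G *ᵥ 1 = 1 := by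
  ext e
  simp [tailMatrix, Matrix.mulVec, dotProduct]

theorem headMatrix_mulVec_branching :
    headMatrix G *ᵥ branching G = G.nonBacktrackingMatrix ℝ *ᵥ 1 := by
  have hdiag : Matrix.diagonal (branching G) *ᵥ 1 = branching G := by
    ext v
    simp [Matrix.mulVec_diagonal]
  rw [← tailMatrix_mulVec_one, Matrix.mulVec_mulVec, nonBacktrackingMatrix_mul_tailMatrix,
    ← Matrix.mulVec_mulVec, hdiag]

end Incidence

section Girth

variable {V : Type*} [Fintype V] [DecidableEq V] {G : SimpleGraph V} [DecidableRel G.Adj]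

omit [Fintype V] [DecidableRel G.Adj] in
theorem nonBacktrackingMatrix_apply (e f : G.Dart) :
    G.nonBacktrackingMatrix ℝ e f = if e.snd = f.fst ∧ e.fst ≠ f.snd then 1 else 0 :=
  rfl

omit [Fintype V] [DecidableRel G.Adj] in
theorem nonBacktrackingMatrix_nonneg (e f : G.Dart) : 0 ≤ G.nonBacktrackingMatrix ℝ e f := by
  rw [nonBacktrackingMatrix_apply]
  positivity

omit [Fintype V] [DecidableRel G.Adj] in
theorem nonBacktrackingMatrix_ne_zero_iff {e f : G.Dart} :
    G.nonBacktrackingMatrix ℝ e f ≠ 0 ↔ e.snd = f.fst ∧ e.fst ≠ f.snd := by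
  simp [nonBacktrackingMatrix_apply]

theorem nonBacktrackingMatrix_pow_symm (k : ℕ) (e f : G.Dart) :
    (G.nonBacktrackingMatrix ℝ ^ k) e.symm f.symm = (G.nonBacktrackingMatrix ℝ ^ k) f e := by
  let reindex := Matrix.reindexAlgEquiv ℝ ℝ (SimpleGraph.Dart.symm_involutive (G := G)).toPerm
  have hone : reindex (G.nonBacktrackingMatrix ℝ) = (G.nonBacktrackingMatrix ℝ)ᵀ := by
    ext e f
    change G.nonBacktrackingMatrix ℝ e.symm f.symm = G.nonBacktrackingMatrix ℝ f e
    simp only [nonBacktrackingMatrix_apply, SimpleGraph.Dart.symm, Prod.fst_swap, Prod.snd_swap,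
      eq_comm, ne_comm]
  have hpow : reindex (G.nonBacktrackingMatrix ℝ ^ k) = (G.nonBacktrackingMatrix ℝ ^ k)ᵀ := by
    rw [map_pow, hone, Matrix.transpose_pow]
  exact congrFun₂ hpow e f

theorem exists_isPath_of_pow_ne_zero {k : ℕ} {a b : G.Dart}
    (hk : ((k + 1 : ℕ) : ℕ∞) < G.egirth) (h : (G.nonBacktrackingMatrix ℝ ^ k) a b ≠ 0) :
    ∃ p : G.Walk a.fst b.snd, p.IsPath ∧ p.length = k + 1 ∧ p.snd = a.snd := by
  induction k generalizing a with
  | zero =>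
    obtain rfl : a = b := by
      by_contra hab
      exact h (by simp [hab])
    exact ⟨.cons a.adj .nil, by simp [a.adj.ne], rfl, rfl⟩
  | succ k ih =>
    rw [pow_succ', Matrix.mul_apply] at h
    obtain ⟨c, -, hc⟩ := Finset.exists_ne_zero_of_sum_ne_zero h
    obtain ⟨hac, hcb⟩ := mul_ne_zero_iff.1 hc
    obtain ⟨hac, hne⟩ := nonBacktrackingMatrix_ne_zero_iff.1 hac
    obtain ⟨p, hp, hlen, hsnd⟩ := ih (lt_of_le_of_lt (by exact_mod_cast Nat.le_succ _) hk) hcb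
    have hadj : G.Adj a.fst c.fst := hac ▸ a.adj
    refine ⟨.cons hadj p, hp.cons fun hmem => ?_, by simp [hlen], by simp [hac]⟩
    have hcycle : (SimpleGraph.Walk.cons hadj (p.takeUntil a.fst hmem)).IsCycle := by
      refine SimpleGraph.Walk.cons_isCycle_iff _ _ |>.2 ⟨hp.takeUntil hmem, fun hedge => hne ?_⟩
      rw [Sym2.eq_swap] at hedge
      rw [(hp.takeUntil hmem).eq_snd_of_mem_edges hedge, p.snd_takeUntil hadj.ne hmem, hsnd]
    refine (hk.trans_le (SimpleGraph.egirth_le_length hcycle)).not_ge ?_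
    have := p.length_takeUntil_le_length hmem
    rw [SimpleGraph.Walk.length_cons]
    exact_mod_cast (by lia)

theorem fst_ne_snd_of_pow_ne_zero {k : ℕ} {a b : G.Dart}
    (hk : ((k + 1 : ℕ) : ℕ∞) < G.egirth) (h : (G.nonBacktrackingMatrix ℝ ^ k) a b ≠ 0) :
    a.fst ≠ b.snd := by
  obtain ⟨p, hp, hlen, -⟩ := exists_isPath_of_pow_ne_zero hk h
  generalize b.snd = v at p
  rintro rfl
  exact k.succ_ne_zero (hlen.symm.trans (SimpleGraph.Walk.isPath_iff_nil.1 hp).length_eq_zero)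

theorem pow_add_ne_zero {n : Type*} [Fintype n] [DecidableEq n] {M : Matrix n n ℝ}
    (hM : ∀ i j, 0 ≤ M i j) {s t : ℕ} {i j k : n} (hij : (M ^ s) i j ≠ 0)
    (hjk : (M ^ t) j k ≠ 0) : (M ^ (s + t)) i k ≠ 0 := by
  have hpow := Matrix.pow_apply_nonneg hM
  rw [pow_add, Matrix.mul_apply]
  refine ne_of_gt (Finset.sum_pos' (fun l _ => mul_nonneg (hpow s i l) (hpow t l k)) ⟨j, ?_⟩)
  exact ⟨Finset.mem_univ j, mul_pos ((hpow s i j).lt_of_ne' hij) ((hpow t j k).lt_of_ne' hjk)⟩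

variable (G) in
/-- The matrix whose entry at `(e, v)` is the number of non-backtracking walks that start with the
directed edge `e`, take `s` further steps and end at `v`. -/
def walkCount (s : ℕ) : Matrix G.Dart V ℝ :=
  G.nonBacktrackingMatrix ℝ ^ s * headMatrix G

theorem walkCount_zero_apply (e : G.Dart) (v : V) :
    walkCount G 0 e v = if e.snd = v then 1 else 0 := by
  simp [walkCount, headMatrix]

theorem walkCount_succ (s : ℕ) :
    walkCount G (s + 1) = G.nonBacktrackingMatrix ℝ * walkCount G s := by
  rw [walkCount, walkCount, pow_succ', Matrix.mul_assoc]

theorem exists_pow_ne_zero_of_walkCount_ne_zero {s : ℕ} {e : G.Dart} {v : V}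
    (h : walkCount G s e v ≠ 0) :
    ∃ f : G.Dart, f.snd = v ∧ (G.nonBacktrackingMatrix ℝ ^ s) e f ≠ 0 := by
  rw [walkCount, Matrix.mul_apply] at h
  obtain ⟨f, -, hf⟩ := Finset.exists_ne_zero_of_sum_ne_zero h
  obtain ⟨hpow, hhead⟩ := mul_ne_zero_iff.1 hf
  exact ⟨f, by simpa [headMatrix] using hhead, hpow⟩

theorem walkCount_fst_eq_zero {s : ℕ} (hs : ((s + 1 : ℕ) : ℕ∞) < G.egirth) (e : G.Dart) :
    walkCount G s e e.fst = 0 := by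
  by_contra h
  obtain ⟨f, hf, hpow⟩ := exists_pow_ne_zero_of_walkCount_ne_zero h
  exact fst_ne_snd_of_pow_ne_zero hs hpow hf.symm

theorem walkCount_mul_walkCount_of_ne {s t : ℕ} (hst : ((s + t + 2 : ℕ) : ℕ∞) < G.egirth)
    {e f : G.Dart} (hfst : e.fst = f.fst) (hne : e ≠ f) (v : V) :
    walkCount G s e v * walkCount G t f v = 0 := by
  by_contra h
  obtain ⟨he, hf⟩ := mul_ne_zero_iff.1 h
  obtain ⟨x, hx, hex⟩ := exists_pow_ne_zero_of_walkCount_ne_zero he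
  obtain ⟨y, hy, hfy⟩ := exists_pow_ne_zero_of_walkCount_ne_zero hf
  rw [← nonBacktrackingMatrix_pow_symm] at hex
  have hturn : (G.nonBacktrackingMatrix ℝ ^ 1) e.symm f ≠ 0 := by
    rw [pow_one, nonBacktrackingMatrix_ne_zero_iff]
    exact ⟨hfst, fun hsnd => hne (SimpleGraph.Dart.ext _ _ (Prod.ext hfst hsnd))⟩
  have hclosed := pow_add_ne_zero nonBacktrackingMatrix_nonneg
    (pow_add_ne_zero nonBacktrackingMatrix_nonneg hex hturn) hfy
  refine fst_ne_snd_of_pow_ne_zero ?_ hclosed (hx.trans hy.symm)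
  rwa [show s + 1 + t + 1 = s + t + 2 by ring]

theorem walkCount_zero_mul_walkCount_succ {t : ℕ} (ht : ((t + 1 : ℕ) : ℕ∞) < G.egirth)
    (e : G.Dart) (v : V) : walkCount G 0 e v * walkCount G (t + 1) e v = 0 := by
  rw [walkCount_zero_apply, ite_mul, one_mul, zero_mul, ite_eq_right_iff]
  rintro rfl
  rw [walkCount_succ, Matrix.mul_apply]
  refine Finset.sum_eq_zero fun f _ => ?_
  by_cases hef : G.nonBacktrackingMatrix ℝ e f = 0
  · rw [hef, zero_mul]
  · rw [(nonBacktrackingMatrix_ne_zero_iff.1 hef).1, walkCount_fst_eq_zero ht, mul_zero]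

theorem walkCount_succ_mul_walkCount_succ {s t : ℕ} (hst : ((s + t + 2 : ℕ) : ℕ∞) < G.egirth)
    (e : G.Dart) (v : V) :
    walkCount G (s + 1) e v * walkCount G (t + 1) e v =
      ∑ f, G.nonBacktrackingMatrix ℝ e f * (walkCount G s f v * walkCount G t f v) := by
  rw [walkCount_succ, walkCount_succ, Matrix.mul_apply, Matrix.mul_apply, Finset.sum_mul_sum]
  refine Finset.sum_congr rfl fun f _ => ?_
  rw [Finset.sum_eq_single_of_mem f (Finset.mem_univ f)]
  · rw [mul_mul_mul_comm, nonBacktrackingMatrix_apply, ite_mul_ite, zero_mul, one_mul]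
  · intro g _ hgf
    rw [mul_mul_mul_comm]
    by_cases hprod : G.nonBacktrackingMatrix ℝ e f * G.nonBacktrackingMatrix ℝ e g = 0
    · rw [hprod, zero_mul]
    · obtain ⟨hf, hg⟩ := mul_ne_zero_iff.1 hprod
      rw [nonBacktrackingMatrix_ne_zero_iff] at hf hg
      rw [walkCount_mul_walkCount_of_ne hst (hf.1.symm.trans hg.1) hgf.symm, mul_zero]

theorem walkCount_mul_walkCount {s t : ℕ} (hst : ((s + t : ℕ) : ℕ∞) < G.egirth) (e : G.Dart)
    (v : V) : walkCount G s e v * walkCount G t e v =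
      if s = t then walkCount G s e v else 0 := by
  induction s generalizing t e with
  | zero =>
    cases t with
    | zero => simp [walkCount_zero_apply]
    | succ t => simpa using walkCount_zero_mul_walkCount_succ (by simpa using hst) e v
  | succ s ih =>
    cases t with
    | zero =>
      rw [mul_comm]
      simpa using walkCount_zero_mul_walkCount_succ (by simpa using hst) e v
    | succ t =>
      have hst' : ((s + t : ℕ) : ℕ∞) < G.egirth := lt_of_le_of_lt (by norm_cast; lia) hst
      rw [walkCount_succ_mul_walkCount_succ (by rwa [show s + t + 2 = s + 1 + (t + 1) by ring])]
      simp only [ih hst', Nat.add_right_cancel_iff]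
      split_ifs
      · rw [walkCount_succ, Matrix.mul_apply]
      · simp

end Girth

section TrialMatrix

variable {V : Type*} [Fintype V] [DecidableEq V] {G : SimpleGraph V} [DecidableRel G.Adj]

theorem walkCount_mulVec (s : ℕ) (x : V → ℝ) :
    walkCount G s *ᵥ x = G.nonBacktrackingMatrix ℝ ^ s *ᵥ (headMatrix G *ᵥ x) := by
  rw [walkCount, Matrix.mulVec_mulVec]

theorem walkCount_zero_mul_adjMatrix :
    walkCount G 0 * G.adjMatrix ℝ = walkCount G 1 + tailMatrix G := by
  simp [walkCount, headMatrix_mul_adjMatrix]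

theorem walkCount_succ_mul_adjMatrix (s : ℕ) :
    walkCount G (s + 1) * G.adjMatrix ℝ =
      walkCount G (s + 2) + walkCount G s * Matrix.diagonal (branching G) := by
  rw [walkCount, Matrix.mul_assoc, headMatrix_mul_adjMatrix, Matrix.mul_add, ← Matrix.mul_assoc,
    ← pow_succ, ← walkCount, pow_succ, Matrix.mul_assoc, nonBacktrackingMatrix_mul_tailMatrix,
    ← Matrix.mul_assoc, ← walkCount]

theorem deformedLaplacian_eq (z : ℝ) :
    G.deformedLaplacian z =
      z ^ 2 • (1 : Matrix V V ℝ) - z • G.adjMatrix ℝ + Matrix.diagonal (branching G) := by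
  rw [SimpleGraph.deformedLaplacian, degMatrix_eq, add_sub_assoc, add_sub_cancel_right]

theorem deformedLaplacian_eq_add {z₀ : ℝ} (hz₀ : z₀ ≠ 0) (z : ℝ) :
    G.deformedLaplacian z = (z ^ 2 - z * z₀) • (1 : Matrix V V ℝ) +
      (1 - z / z₀) • Matrix.diagonal (branching G) + (z / z₀) • G.deformedLaplacian z₀ := by
  rw [deformedLaplacian_eq, deformedLaplacian_eq]
  match_scalars <;> field_simp <;> ring

variable (G) in
/-- The matrix whose row at `e` is the trial vector `∑ s < m, z⁻ˢ N_s(e, ·)`, where `N_s` is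
`walkCount G s`. -/
noncomputable def trialMatrix (z : ℝ) (m : ℕ) : Matrix G.Dart V ℝ :=
  ∑ s ∈ Finset.range m, z⁻¹ ^ s • walkCount G s

theorem trialMatrix_apply (z : ℝ) (m : ℕ) (e : G.Dart) (v : V) :
    trialMatrix G z m e v = ∑ s ∈ Finset.range m, z⁻¹ ^ s * walkCount G s e v := by
  simp [trialMatrix, Matrix.sum_apply]

theorem trialMatrix_succ_mul_deformedLaplacian {z : ℝ} (hz : z ≠ 0) (n : ℕ) :
    trialMatrix G z (n + 1) * G.deformedLaplacian z =
      z ^ 2 • walkCount G 0 - z • tailMatrix G - (z ^ 2 * z⁻¹ ^ (n + 1)) • walkCount G (n + 1) +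
        z⁻¹ ^ n • (walkCount G n * Matrix.diagonal (branching G)) := by
  induction n with
  | zero =>
    simp only [trialMatrix, deformedLaplacian_eq, zero_add, Finset.sum_range_one, pow_zero,
      one_smul, Matrix.mul_add, Matrix.mul_sub, Matrix.mul_smul, Matrix.mul_one,
      walkCount_zero_mul_adjMatrix]
    match_scalars <;> field_simp
  | succ n ih =>
    have hstep : walkCount G (n + 1) * G.deformedLaplacian z =
        z ^ 2 • walkCount G (n + 1) - z • walkCount G (n + 2) -
          z • (walkCount G n * Matrix.diagonal (branching G)) +
          walkCount G (n + 1) * Matrix.diagonal (branching G) := by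
      simp only [deformedLaplacian_eq, Matrix.mul_add, Matrix.mul_sub, Matrix.mul_smul,
        Matrix.mul_one, walkCount_succ_mul_adjMatrix, smul_add]
      abel
    rw [trialMatrix, Finset.sum_range_succ, Matrix.add_mul, ← trialMatrix, ih, Matrix.smul_mul,
      hstep]
    simp only [inv_pow]
    match_scalars <;> field_simp <;> ring

section LargeGirth

variable {m : ℕ} (hgirth : ((2 * m : ℕ) : ℕ∞) ≤ G.egirth)

include hgirth

theorem walkCount_fst_eq_zero_of_le {s : ℕ} (hs : s ≤ m) (e : G.Dart) :
    walkCount G s e e.fst = 0 := by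
  refine walkCount_fst_eq_zero ?_ e
  rcases le_or_gt s 1 with hs1 | hs1
  · exact lt_of_lt_of_le (by exact_mod_cast (by lia)) G.three_le_egirth
  · exact lt_of_lt_of_le (by exact_mod_cast (by lia)) hgirth

theorem trialMatrix_fst_eq_zero (z : ℝ) (e : G.Dart) : trialMatrix G z m e e.fst = 0 := by
  rw [trialMatrix_apply]
  refine Finset.sum_eq_zero fun s hs => ?_
  rw [walkCount_fst_eq_zero_of_le hgirth (Finset.mem_range.1 hs).le, mul_zero]

theorem trialMatrix_mul_walkCount (z : ℝ) {t : ℕ} (ht : t ≤ m) (e : G.Dart) (v : V) :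
    trialMatrix G z m e v * walkCount G t e v =
      if t < m then z⁻¹ ^ t * walkCount G t e v else 0 := by
  have hterm : ∀ s ∈ Finset.range m, z⁻¹ ^ s * walkCount G s e v * walkCount G t e v =
      if t = s then z⁻¹ ^ s * walkCount G s e v else 0 := by
    intro s hs
    have hst : s + t < 2 * m := by
      rw [Finset.mem_range] at hs
      lia
    rw [mul_assoc, walkCount_mul_walkCount ((Nat.cast_lt.2 hst).trans_le hgirth), mul_ite,
      mul_zero]
    simp only [eq_comm]
  rw [trialMatrix_apply, Finset.sum_mul, Finset.sum_congr rfl hterm, Finset.sum_ite_eq]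
  simp only [Finset.mem_range]

theorem trialMatrix_dotProduct_walkCount (z : ℝ) {t : ℕ} (ht : t ≤ m) (φ : V → ℝ) (e : G.Dart) :
    trialMatrix G z m e ⬝ᵥ (walkCount G t * Matrix.diagonal φ) e =
      if t < m then z⁻¹ ^ t * (walkCount G t *ᵥ φ) e else 0 := by
  simp only [dotProduct, Matrix.mulVec, Matrix.mul_diagonal, ← mul_assoc,
    trialMatrix_mul_walkCount hgirth z ht, ite_mul, zero_mul, Finset.mul_sum]
  split_ifs
  · rfl
  · exact Finset.sum_const_zero

theorem trialMatrix_dotProduct_trialMatrix (z : ℝ) (φ : V → ℝ) (e : G.Dart) :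
    trialMatrix G z m e ⬝ᵥ (trialMatrix G z m * Matrix.diagonal φ) e =
      ∑ s ∈ Finset.range m, z⁻¹ ^ (2 * s) * (walkCount G s *ᵥ φ) e := by
  have hrow : (trialMatrix G z m * Matrix.diagonal φ) e =
      ∑ s ∈ Finset.range m, z⁻¹ ^ s • (walkCount G s * Matrix.diagonal φ) e := by
    ext v
    simp [trialMatrix, Matrix.sum_apply, Finset.sum_mul, mul_assoc]
  rw [hrow, dotProduct_sum]
  refine Finset.sum_congr rfl fun s hs => ?_
  rw [Finset.mem_range] at hs
  rw [dotProduct_smul, trialMatrix_dotProduct_walkCount hgirth z hs.le, if_pos hs, smul_eq_mul,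
    two_mul, pow_add, mul_assoc]

theorem trialMatrix_mul_deformedLaplacian_fst (hm : 1 ≤ m) {z : ℝ} (hz : z ≠ 0) (e : G.Dart) :
    (trialMatrix G z m * G.deformedLaplacian z) e e.fst = -z := by
  obtain ⟨n, rfl⟩ := Nat.exists_eq_add_of_le' hm
  have hzero {s : ℕ} (hs : s ≤ n + 1) := walkCount_fst_eq_zero_of_le hgirth hs e
  simp [trialMatrix_succ_mul_deformedLaplacian hz, Matrix.mul_diagonal, hzero, tailMatrix]

theorem trialMatrix_dotProduct_deformedLaplacian (hm : 1 ≤ m) {z : ℝ} (hz : z ≠ 0) (e : G.Dart) :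
    trialMatrix G z m e ⬝ᵥ (trialMatrix G z m * G.deformedLaplacian z) e =
      z ^ 2 * (1 + z⁻¹ ^ (2 * m) * (G.nonBacktrackingMatrix ℝ ^ m *ᵥ 1) e) := by
  obtain ⟨n, rfl⟩ := Nat.exists_eq_add_of_le' hm
  set F := trialMatrix G z (n + 1)
  have hfirst : F e ⬝ᵥ walkCount G 0 e = 1 := by
    simpa [Matrix.diagonal_one, walkCount_mulVec, headMatrix_mulVec_one] using
      trialMatrix_dotProduct_walkCount hgirth z (Nat.zero_le _) 1 e
  have htail : F e ⬝ᵥ tailMatrix G e = 0 := by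
    simpa [tailMatrix, dotProduct] using trialMatrix_fst_eq_zero hgirth z e
  have hbeyond : F e ⬝ᵥ walkCount G (n + 1) e = 0 := by
    simpa [Matrix.diagonal_one] using trialMatrix_dotProduct_walkCount hgirth z le_rfl 1 e
  have hlast : F e ⬝ᵥ (walkCount G n * Matrix.diagonal (branching G)) e =
      z⁻¹ ^ n * (G.nonBacktrackingMatrix ℝ ^ (n + 1) *ᵥ 1) e := by
    rw [trialMatrix_dotProduct_walkCount hgirth z n.le_succ, if_pos n.lt_succ_self,
      walkCount_mulVec, headMatrix_mulVec_branching, Matrix.mulVec_mulVec, pow_succ]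
  have hrow : (F * G.deformedLaplacian z) e =
      z ^ 2 • walkCount G 0 e - z • tailMatrix G e -
        (z ^ 2 * z⁻¹ ^ (n + 1)) • walkCount G (n + 1) e +
        z⁻¹ ^ n • (walkCount G n * Matrix.diagonal (branching G)) e :=
    congrFun (trialMatrix_succ_mul_deformedLaplacian hz n) e
  rw [hrow]
  simp only [dotProduct_add, dotProduct_sub, dotProduct_smul, hfirst, htail, hbeyond, hlast,
    smul_eq_mul, inv_pow]
  field_simp
  ring

section EigenvectorWeights

variable {w : G.Dart → ℝ} {z₀ : ℝ}

theorem trace_weightedGram_trialMatrix_mul_diagonal (hz₀ : z₀ ≠ 0)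
    (hw : w ᵥ* G.nonBacktrackingMatrix ℝ = z₀ ^ 2 • w) (φ : V → ℝ) :
    (weightedGram (trialMatrix G z₀ m) w * Matrix.diagonal φ).trace =
      m * (w ⬝ᵥ (headMatrix G *ᵥ φ)) := by
  have hrows : (fun e => trialMatrix G z₀ m e ⬝ᵥ (trialMatrix G z₀ m * Matrix.diagonal φ) e) =
      ∑ s ∈ Finset.range m, z₀⁻¹ ^ (2 * s) • (walkCount G s *ᵥ φ) := by
    ext e
    simp [trialMatrix_dotProduct_trialMatrix hgirth, Finset.sum_apply]
  have hterm (s : ℕ) : w ⬝ᵥ (z₀⁻¹ ^ (2 * s) • (walkCount G s *ᵥ φ)) =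
      w ⬝ᵥ (headMatrix G *ᵥ φ) := by
    rw [dotProduct_smul, walkCount_mulVec, dotProduct_pow_mulVec hw, smul_eq_mul, ← pow_mul,
      inv_pow, inv_mul_cancel_left₀ (pow_ne_zero _ hz₀)]
  rw [trace_weightedGram_mul, hrows, dotProduct_sum]
  simp only [hterm, Finset.sum_const, Finset.card_range, nsmul_eq_mul]

theorem trace_weightedGram_trialMatrix (hz₀ : z₀ ≠ 0)
    (hw : w ᵥ* G.nonBacktrackingMatrix ℝ = z₀ ^ 2 • w) :
    (weightedGram (trialMatrix G z₀ m) w).trace = m * ∑ e, w e := by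
  simpa [Matrix.diagonal_one, headMatrix_mulVec_one, dotProduct_one] using
    trace_weightedGram_trialMatrix_mul_diagonal hgirth hz₀ hw 1

theorem trace_weightedGram_trialMatrix_mul_deformedLaplacian_self (hm : 1 ≤ m) (hz₀ : z₀ ≠ 0)
    (hw : w ᵥ* G.nonBacktrackingMatrix ℝ = z₀ ^ 2 • w) :
    (weightedGram (trialMatrix G z₀ m) w * G.deformedLaplacian z₀).trace =
      2 * z₀ ^ 2 * ∑ e, w e := by
  have hrows : (fun e => trialMatrix G z₀ m e ⬝ᵥ (trialMatrix G z₀ m * G.deformedLaplacian z₀) e) =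
      z₀ ^ 2 • (1 + z₀⁻¹ ^ (2 * m) • (G.nonBacktrackingMatrix ℝ ^ m *ᵥ 1)) :=
    funext fun e => trialMatrix_dotProduct_deformedLaplacian hgirth hm hz₀ e
  rw [trace_weightedGram_mul, hrows, dotProduct_smul, dotProduct_add, dotProduct_smul,
    dotProduct_pow_mulVec hw, dotProduct_one, smul_eq_mul, smul_eq_mul, ← pow_mul, inv_pow,
    inv_mul_cancel_left₀ (pow_ne_zero _ hz₀)]
  ring

theorem trace_weightedGram_trialMatrix_mul_deformedLaplacian (hm : 1 ≤ m) (hz₀ : z₀ ≠ 0)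
    (hw : w ᵥ* G.nonBacktrackingMatrix ℝ = z₀ ^ 2 • w) (z : ℝ) :
    (weightedGram (trialMatrix G z₀ m) w * G.deformedLaplacian z).trace =
      (m * (z - z₀) ^ 2 + 2 * z₀ * z) * ∑ e, w e := by
  have hbranching : (weightedGram (trialMatrix G z₀ m) w * Matrix.diagonal (branching G)).trace =
      m * (z₀ ^ 2 * ∑ e, w e) := by
    rw [trace_weightedGram_trialMatrix_mul_diagonal hgirth hz₀ hw, headMatrix_mulVec_branching,
      Matrix.dotProduct_mulVec, hw, smul_dotProduct, dotProduct_one, smul_eq_mul]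
  rw [deformedLaplacian_eq_add hz₀ z]
  simp only [Matrix.mul_add, Matrix.mul_smul, Matrix.mul_one, Matrix.trace_add, Matrix.trace_smul,
    smul_eq_mul, hbranching, trace_weightedGram_trialMatrix hgirth hz₀ hw,
    trace_weightedGram_trialMatrix_mul_deformedLaplacian_self hgirth hm hz₀ hw]
  field_simp
  ring

end EigenvectorWeights

theorem trialMatrix_mul_deformedLaplacian_sub_fst (hm : 1 ≤ m) {z₀ : ℝ} (hz₀ : z₀ ≠ 0) (z c : ℝ)
    (e : G.Dart) :
    (trialMatrix G z₀ m * (G.deformedLaplacian z - c • (1 : Matrix V V ℝ))) e e.fst = -z := by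
  rw [deformedLaplacian_eq_add hz₀ z]
  simp [Matrix.mul_add, Matrix.mul_sub, Matrix.mul_diagonal, trialMatrix_fst_eq_zero hgirth,
    trialMatrix_mul_deformedLaplacian_fst hgirth hm hz₀, hz₀]

end LargeGirth

end TrialMatrix

section Radius

open PerronFrobenius

variable {V : Type*} [Fintype V] [DecidableEq V] {G : SimpleGraph V} [DecidableRel G.Adj]

variable (G) in
theorem nonBacktrackingRadius_eq_perronRoot :
    G.nonBacktrackingRadius = perronRoot (G.nonBacktrackingMatrix ℝ) := by
  have hmap : (G.nonBacktrackingMatrix ℝ).map Complex.ofReal = G.nonBacktrackingMatrix ℂ := by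
    ext e f
    simp [SimpleGraph.nonBacktrackingMatrix, apply_ite Complex.ofReal]
  rw [SimpleGraph.nonBacktrackingRadius, perronRoot, hmap]

theorem nonempty_dart_of_radius_ne_zero (h : G.nonBacktrackingRadius ≠ 0) : Nonempty G.Dart := by
  by_contra hempty
  rw [not_nonempty_iff] at hempty
  exact h (by simp [SimpleGraph.nonBacktrackingRadius, spectralRadius])

theorem one_le_radius_of_two_le_degree [Nonempty V] (h : ∀ v, 2 ≤ G.degree v) :
    1 ≤ G.nonBacktrackingRadius := by
  obtain ⟨u, hu⟩ := (G.degree_pos_iff_exists_adj (Classical.arbitrary V)).1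
    (zero_lt_two.trans_le (h _))
  have : Nonempty G.Dart := ⟨⟨(_, u), hu⟩⟩
  rw [nonBacktrackingRadius_eq_perronRoot]
  refine le_perronRoot_of_smul_le_mulVec nonBacktrackingMatrix_nonneg zero_le_one one_ne_zero ?_
  rw [one_smul, ← headMatrix_mulVec_branching, ← headMatrix_mulVec_one]
  refine mulVec_mono (fun e v => ?_) fun v => ?_
  · simp only [headMatrix, Matrix.of_apply]
    positivity
  · have : (2 : ℝ) ≤ G.degree v := by exact_mod_cast h v
    rw [branching, Pi.one_apply]
    linarith

theorem exists_nonneg_sum_eq_vecMul (h : G.nonBacktrackingRadius ≠ 0) {c : ℝ} (hc : 0 < c) :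
    ∃ w : G.Dart → ℝ, 0 ≤ w ∧ ∑ e, w e = c ∧
      w ᵥ* G.nonBacktrackingMatrix ℝ = G.nonBacktrackingRadius • w := by
  have := nonempty_dart_of_radius_ne_zero h
  obtain ⟨w, ⟨hw, hsum⟩, heig⟩ :=
    exists_mem_stdSimplex_vecMul_eq (nonBacktrackingMatrix_nonneg (G := G))
  refine ⟨c • w, smul_nonneg hc.le hw, by simp [← Finset.mul_sum, hsum], ?_⟩
  rw [Matrix.smul_vecMul, heig, nonBacktrackingRadius_eq_perronRoot, smul_comm]

theorem exists_degree_le_one_of_radius_eq_zero [Nonempty V] (h : G.nonBacktrackingRadius = 0) :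
    ∃ v, G.degree v ≤ 1 := by
  by_contra! hdeg
  exact (one_le_radius_of_two_le_degree hdeg).not_gt (h ▸ one_pos)

end Radius

section LowDegree

variable {V : Type*} [Fintype V] [DecidableEq V]

theorem trace_weightedGram_one_single_mul (v : V) (M : Matrix V V ℝ) :
    (weightedGram 1 (Pi.single v 1) * M).trace = M v v := by
  simp [weightedGram, Matrix.trace, Pi.single_apply]

variable {G : SimpleGraph V} [DecidableRel G.Adj] {v : V}

theorem deformedLaplacian_apply_self_le (hv : G.degree v ≤ 1) (z : ℝ) :
    G.deformedLaplacian z v v ≤ z ^ 2 := by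
  have : (G.degree v : ℝ) ≤ 1 := by exact_mod_cast hv
  simpa [deformedLaplacian_eq, branching] using this

theorem deformedLaplacian_sub_sq_row_ne_zero (hv : G.degree v ≤ 1) {z : ℝ} (hz : z ≠ 0) :
    (G.deformedLaplacian z - z ^ 2 • (1 : Matrix V V ℝ)) v ≠ 0 := by
  intro h
  have hentry (u : V) := congrFun h u
  rcases Nat.le_one_iff_eq_zero_or_eq_one.1 hv with hdeg | hdeg
  · simpa [deformedLaplacian_eq, branching, hdeg] using hentry v
  · obtain ⟨u, hu⟩ := (G.degree_pos_iff_exists_adj v).1 (hdeg ▸ one_pos)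
    simpa [deformedLaplacian_eq, hu, hu.ne, hz] using hentry u

end LowDegree

end NonBacktracking

open NonBacktracking in
theorem corollary5_general {V : Type*} [Fintype V] [DecidableEq V] [Nonempty V]
    (G : SimpleGraph V) [DecidableRel G.Adj] {m : ℕ} (hm : 1 ≤ m)
    (hgirth : ((2 * m : ℕ) : ℕ∞) ≤ G.egirth) {σ : ℝ} (hσ : σ ^ 2 = G.nonBacktrackingRadius) :
    (∀ z : ℝ, z ≠ 0 →
      ¬ (G.deformedLaplacian z -
          ((z + σ) ^ 2 - 2 * σ * z / m) • (1 : Matrix V V ℝ)).PosSemidef) ∧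
    ∃ X : Matrix V V ℝ, X.PosSemidef ∧ X.trace = 1 ∧
      ∀ z : ℝ, (X * G.deformedLaplacian z).trace ≤ (z + σ) ^ 2 - 2 * σ * z / m := by
  rcases eq_or_ne σ 0 with rfl | hσ0
  · obtain ⟨v, hv⟩ := exists_degree_le_one_of_radius_eq_zero (by simpa using hσ.symm)
    have hw : 0 ≤ (Pi.single v 1 : V → ℝ) := Pi.single_nonneg.2 zero_le_one
    have htrace : (weightedGram (1 : Matrix V V ℝ) (Pi.single v 1)).trace = 1 := by
      simpa using trace_weightedGram_one_single_mul v 1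
    have hle (z : ℝ) := (trace_weightedGram_one_single_mul v (G.deformedLaplacian z)).trans_le
      (deformedLaplacian_apply_self_le hv z)
    simp only [add_zero, mul_zero, zero_mul, zero_div, sub_zero]
    refine ⟨fun z hz => not_posSemidef_sub_smul_one (F := 1) hw
      (by simpa [htrace] using hle z) (e := v) (by simp) ?_, _, posSemidef_weightedGram 1 hw,
      htrace, hle⟩
    simpa using deformedLaplacian_sub_sq_row_ne_zero hv hz
  · obtain ⟨w, hw, hsum, heig⟩ := exists_nonneg_sum_eq_vecMul (hσ ▸ pow_ne_zero 2 hσ0)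
      (inv_pos.2 (Nat.cast_pos.2 hm))
    have hm0 : (m : ℝ) ≠ 0 := Nat.cast_ne_zero.2 (Nat.one_le_iff_ne_zero.1 hm)
    rw [← hσ, ← neg_sq] at heig
    have hσ' := neg_ne_zero.2 hσ0
    obtain ⟨e, -, he⟩ := Finset.exists_ne_zero_of_sum_ne_zero (hsum ▸ inv_ne_zero hm0)
    have htrace : (weightedGram (trialMatrix G (-σ) m) w).trace = 1 := by
      rw [trace_weightedGram_trialMatrix hgirth hσ' heig, hsum, mul_inv_cancel₀ hm0]
    have heq (z : ℝ) : (weightedGram (trialMatrix G (-σ) m) w * G.deformedLaplacian z).trace =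
        (z + σ) ^ 2 - 2 * σ * z / m := by
      rw [trace_weightedGram_trialMatrix_mul_deformedLaplacian hgirth hm hσ' heig, hsum]
      field_simp
      ring
    refine ⟨fun z hz => not_posSemidef_sub_smul_one hw (by rw [htrace, heq, mul_one]) he
      fun h => ?_, _, posSemidef_weightedGram _ hw, htrace, fun z => (heq z).le⟩
    have hrow := trialMatrix_mul_deformedLaplacian_sub_fst hgirth hm hσ' z
    exact hz (neg_eq_zero.1 ((hrow _ e).symm.trans (congrFun h e.fst)))

theorem corollary5 {V : Type*} [Fintype V] [DecidableEq V] [Nonempty V]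
    (G : SimpleGraph V) [DecidableRel G.Adj] (m : ℕ) (hm : 1 ≤ m)
    (hgirth : ((2 * m + 1 : ℕ) : ℕ∞) ≤ G.egirth) :
    (∀ z : ℝ, z < 0 →
      ¬ (G.deformedLaplacian z -
          ((z + √G.nonBacktrackingRadius) ^ 2 - 2 * √G.nonBacktrackingRadius * z / m) •
            (1 : Matrix V V ℝ)).PosSemidef) ∧
    ∃ X : Matrix V V ℝ, X.PosSemidef ∧ X.trace = 1 ∧
      ∀ z : ℝ, z < 0 →
        (X * G.deformedLaplacian z).trace ≤
          (z + √G.nonBacktrackingRadius) ^ 2 - 2 * √G.nonBacktrackingRadius * z / m := by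
  obtain ⟨hnot, X, hX, htrace, hle⟩ := corollary5_general G hm
    (le_trans (by exact_mod_cast Nat.le_succ _) hgirth) (Real.sq_sqrt ENNReal.toReal_nonneg)
  exact ⟨fun z hz => hnot z hz.ne, X, hX, htrace, fun z _ => hle z⟩
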